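/- Let $n\ge 0$ and let $E,Q,L\in\mathbb F^{n,n}$ with $\mathbb F=\mathbb C$ or $\mathbb F=\mathbb R$; for a matrix $W$ let $W^\star$ denote its conjugate transpose if $\mathbb F=\mathbb C$ and its transpose if $\mathbb F=\mathbb R$, and let $W\ge 0$ ($W\le 0$) mean that $W=W^\star$ is positive (negative) semidefinite. Assume that $E^\star Q=Q^\star E\ge 0$ and $L+L^\star\le 0$, that the pencil $P(\lambda)=\lambda E-LQ$ is regular, i.e. $\det(\lambda_0E-LQ)\ne 0$ for some $\lambda_0\in\mathbb C$, and that it has index at most one, i.e. all blocks $\lambda N-I$ ($N$ a nilpotent Jordan block) belonging to the eigenvalue $\infty$ in its complex Kronecker canonical form have size at most one. Then there exist a partition $(n_1,n_2,n_3,n_4)$ of $n$ (parts may be zero), a unitary matrix $\widetilde U\in\mathbb C^{n,n}$ and an invertible matrix $\widetilde X\in\mathbb C^{n,n}$ such that, partitioning conformably with $(n_1,n_2,n_3,n_4)$, $$\widetilde UQ\widetilde X=\begin{pmatrix}Q_{11}&Q_{12}&0&0\\Q_{21}&Q_{22}&0&0\\0&0&0&0\\Q_{41}&Q_{42}&0&I\end{pmatrix},\qquad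 \widetilde UE\widetilde X=\begin{pmatrix}E_{11}&0&0&0\\E_{21}&E_{22}&0&0\\0&0&I&0\\0&0&0&0\end{pmatrix},$$ $$\widetilde ULQ\widetilde X=\begin{pmatrix}A_{11}&0&0&A_{14}\\A_{21}&0&0&A_{24}\\A_{31}&A_{32}&0&A_{34}\\0&0&0&A_{44}\end{pmatrix},$$ where $E_{11}$, $E_{22}$ and $A_{11}$ are lower triangular and invertible, and $A_{44}$ and $\begin{pmatrix}Q_{11}&Q_{12}\\Q_{21}&Q_{22}\end{pmatrix}$ are invertible. If $\mathbb F=\mathbb R$, there also exist such a partition, a real orthogonal $\widetilde U$ and a real invertible $\widetilde X$ for which all of the above holds, except that $A_{11}$ (still invertible) is only lower quasi-triangular, i.e. lower block triangular with diagonal blocks of sizes $1\times 1$ and $2\times 2$. -/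

import Mathlib

open Matrix
open scoped ComplexOrder

/-! ### Matrix pencils `λ E - A`: regularity, Kronecker canonical form, index -/

/-- The square pencil `λ E - A` is regular: `det (λ₀ E - A) ≠ 0` for some `λ₀ ∈ ℂ`. -/
def IsRegularPencil {n : ℕ} (E A : Matrix (Fin n) (Fin n) ℂ) : Prop :=
  ∃ z : ℂ, (z • E - A).det ≠ 0

/-- The types of blocks in the Kronecker canonical form of a complex pencil:
`right ε` is `𝓛_ε` (size `ε × (ε + 1)`), `left η` is `𝓛_ηᵀ` (size `(η + 1) × η`),
`jordan ρ μ` is the Jordan block `𝓙_ρ^μ` and `nilp σ` is the block `𝓝_σ` of the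
eigenvalue infinity. -/
inductive KroneckerBlock : Type
  | right (ε : ℕ)
  | left (η : ℕ)
  | jordan (ρ : ℕ+) (μ : ℂ)
  | nilp (σ : ℕ+)

namespace KroneckerBlock

/-- Number of rows of a Kronecker block. -/
def rows : KroneckerBlock → ℕ
  | right ε => ε
  | left η => η + 1
  | jordan ρ _ => ρ
  | nilp σ => σ

/-- Number of columns of a Kronecker block. -/
def cols : KroneckerBlock → ℕ
  | right ε => ε + 1
  | left η => η
  | jordan ρ _ => ρ
  | nilp σ => σ

/-- The coefficient `E` of a Kronecker block `λ E - A`. -/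
def coeffE (b : KroneckerBlock) : Matrix (Fin b.rows) (Fin b.cols) ℂ :=
  Matrix.of fun i j =>
    match b with
    | right _ => if (j : ℕ) = i then 1 else 0
    | left _ => if (i : ℕ) = j then 1 else 0
    | jordan _ _ => if (i : ℕ) = j then 1 else 0
    | nilp _ => if (j : ℕ) = i + 1 then 1 else 0

/-- The coefficient `A` of a Kronecker block `λ E - A`. -/
def coeffA (b : KroneckerBlock) : Matrix (Fin b.rows) (Fin b.cols) ℂ :=
  Matrix.of fun i j =>
    match b with
    | right _ => if (j : ℕ) = i + 1 then 1 else 0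
    | left _ => if (i : ℕ) = j + 1 then 1 else 0
    | jordan _ μ => if (i : ℕ) = j then μ else if (j : ℕ) = i + 1 then 1 else 0
    | nilp _ => if (i : ℕ) = j then 1 else 0

/-- The size of a block of the eigenvalue infinity (and `0` for all other blocks). -/
def nilpSize : KroneckerBlock → ℕ
  | nilp σ => σ
  | _ => 0

end KroneckerBlock

/-- `diag (b 0, b 1, …)` is a Kronecker canonical form of the pencil `λ E - A`: there are
nonsingular `S` and `T` with `S (λ E - A) T = diag (b 0, b 1, …)`. -/
def IsKroneckerForm {n m k : ℕ} (E A : Matrix (Fin n) (Fin m) ℂ)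
    (b : Fin k → KroneckerBlock) : Prop :=
  ∃ (r : (Σ i, Fin (b i).rows) ≃ Fin n) (c : (Σ i, Fin (b i).cols) ≃ Fin m)
    (S : Matrix (Fin n) (Fin n) ℂ) (T : Matrix (Fin m) (Fin m) ℂ),
    IsUnit S ∧ IsUnit T ∧
    (S * E * T).submatrix r c = blockDiagonal' (fun i => (b i).coeffE) ∧
    (S * A * T).submatrix r c = blockDiagonal' (fun i => (b i).coeffA)

/-- `ν` is the index of the pencil `λ E - A`: the size of the largest block of the eigenvalue
infinity in the Kronecker canonical form (`0` if there is no such block). -/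
def HasIndex {n m : ℕ} (E A : Matrix (Fin n) (Fin m) ℂ) (ν : ℕ) : Prop :=
  ∃ (k : ℕ) (b : Fin k → KroneckerBlock), IsKroneckerForm E A b ∧
    ν = Finset.univ.sup fun i => (b i).nilpSize

/-! ### The condensed form -/

/-- `M` is lower quasi-triangular: lower block triangular with respect to a partition of the
indices into consecutive blocks of sizes `1` and `2`. -/
def IsLowerQuasiTriangular {𝕜 : Type*} [Zero 𝕜] {m : ℕ} (M : Matrix (Fin m) (Fin m) 𝕜) : Prop :=
  ∃ b : Fin m → ℕ, Monotone b ∧ (∀ t, (Finset.univ.filter fun i => b i = t).card ≤ 2) ∧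
    M.BlockTriangular (OrderDual.toDual ∘ b)

/-- The identification of the index set of matrices partitioned conformably with
`(n₁, n₂, n₃, n₄)` with `{0, …, n - 1}`, keeping the order of the indices. -/
def partitionEquiv {n n₁ n₂ n₃ n₄ : ℕ} (h : (n₁ + n₂) + (n₃ + n₄) = n) :
    (Fin n₁ ⊕ Fin n₂) ⊕ (Fin n₃ ⊕ Fin n₄) ≃ Fin n :=
  ((Equiv.sumCongr finSumFinEquiv finSumFinEquiv).trans finSumFinEquiv).trans (finCongr h)

/-- There are a partition `(n₁, n₂, n₃, n₄)` of `n`, a unitary (orthogonal if `𝕜 = ℝ`) matrix `U`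
and an invertible matrix `X`, with entries in `𝕜`, such that conformably with the partition

`U Q X = [Q₁₁ Q₁₂ 0 0; Q₂₁ Q₂₂ 0 0; 0 0 0 0; Q₄₁ Q₄₂ 0 I]`,
`U E X = [E₁₁ 0 0 0; E₂₁ E₂₂ 0 0; 0 0 I 0; 0 0 0 0]`,
`U L Q X = [A₁₁ 0 0 A₁₄; A₂₁ 0 0 A₂₄; A₃₁ A₃₂ 0 A₃₄; 0 0 0 A₄₄]`,

where `E₁₁`, `E₂₂` are lower triangular, `A₁₁` has the triangular shape `Tri`, and
`E₁₁`, `E₂₂`, `A₁₁`, `A₄₄`, `[Q₁₁ Q₁₂; Q₂₁ Q₂₂]` are invertible. -/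
def HasCondensedForm {𝕜 : Type*} [RCLike 𝕜] {n : ℕ} (E Q L : Matrix (Fin n) (Fin n) 𝕜)
    (Tri : ∀ {m : ℕ}, Matrix (Fin m) (Fin m) 𝕜 → Prop) : Prop :=
  ∃ (n₁ n₂ n₃ n₄ : ℕ) (h : (n₁ + n₂) + (n₃ + n₄) = n) (U X : Matrix (Fin n) (Fin n) 𝕜)
    (Q₁₁ : Matrix (Fin n₁) (Fin n₁) 𝕜) (Q₁₂ : Matrix (Fin n₁) (Fin n₂) 𝕜)
    (Q₂₁ : Matrix (Fin n₂) (Fin n₁) 𝕜) (Q₂₂ : Matrix (Fin n₂) (Fin n₂) 𝕜)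
    (Q₄₁ : Matrix (Fin n₄) (Fin n₁) 𝕜) (Q₄₂ : Matrix (Fin n₄) (Fin n₂) 𝕜)
    (E₁₁ : Matrix (Fin n₁) (Fin n₁) 𝕜) (E₂₁ : Matrix (Fin n₂) (Fin n₁) 𝕜)
    (E₂₂ : Matrix (Fin n₂) (Fin n₂) 𝕜)
    (A₁₁ : Matrix (Fin n₁) (Fin n₁) 𝕜) (A₁₄ : Matrix (Fin n₁) (Fin n₄) 𝕜)
    (A₂₁ : Matrix (Fin n₂) (Fin n₁) 𝕜) (A₂₄ : Matrix (Fin n₂) (Fin n₄) 𝕜)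
    (A₃₁ : Matrix (Fin n₃) (Fin n₁) 𝕜) (A₃₂ : Matrix (Fin n₃) (Fin n₂) 𝕜)
    (A₃₄ : Matrix (Fin n₃) (Fin n₄) 𝕜) (A₄₄ : Matrix (Fin n₄) (Fin n₄) 𝕜),
    U ∈ Matrix.unitaryGroup (Fin n) 𝕜 ∧ IsUnit X ∧
    (U * Q * X).submatrix (partitionEquiv h) (partitionEquiv h) =
      fromBlocks (fromBlocks Q₁₁ Q₁₂ Q₂₁ Q₂₂) (fromBlocks 0 0 0 0)
        (fromBlocks 0 0 Q₄₁ Q₄₂) (fromBlocks 0 0 0 1) ∧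
    (U * E * X).submatrix (partitionEquiv h) (partitionEquiv h) =
      fromBlocks (fromBlocks E₁₁ 0 E₂₁ E₂₂) (fromBlocks 0 0 0 0)
        (fromBlocks 0 0 0 0) (fromBlocks 1 0 0 0) ∧
    (U * (L * Q) * X).submatrix (partitionEquiv h) (partitionEquiv h) =
      fromBlocks (fromBlocks A₁₁ 0 A₂₁ 0) (fromBlocks 0 A₁₄ 0 A₂₄)
        (fromBlocks A₃₁ A₃₂ 0 0) (fromBlocks 0 A₃₄ 0 A₄₄) ∧
    E₁₁.IsLowerTriangular ∧ IsUnit E₁₁ ∧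
    E₂₂.IsLowerTriangular ∧ IsUnit E₂₂ ∧
    Tri A₁₁ ∧ IsUnit A₁₁ ∧
    IsUnit A₄₄ ∧ IsUnit (fromBlocks Q₁₁ Q₁₂ Q₂₁ Q₂₂)

/-! ### Orthonormal block triangularization -/

/-! Regularity and index at most one are used only through one consequence: `E x = 0` and `L Q x = E
y` force `x = 0`. Hence `E` and `Q` have no common kernel, `L Q` is injective on `ker E`, and by
dimension the whole space is `ran E ⊕ L Q (ker E)`. The symmetry of `Eᴴ Q` gives `Q (ker E) = (ran
E)ᗮ` and `E (ker Q) = (ran Q)ᗮ`, so the codomain is the orthogonal sum of the core `C = ran E ∩ ran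
Q`, `(ran Q)ᗮ` and `(ran E)ᗮ`.

On the domain side, `E` maps `D = {x | E x ∈ ran Q, L Q x ∈ ran E}` bijectively onto `C`, `E` maps
`ker Q` onto `(ran Q)ᗮ`, and `Q` maps `ker E` onto `(ran E)ᗮ`. Inside `D` let `K` be the kernel of
`L Q` compressed to `C`, and split `C` orthogonally into `W₂ = E K` and its complement `W₁`.
Orthonormal bases of `W₁`, `W₂`, `(ran Q)ᗮ`, `(ran E)ᗮ`, pulled back by `E`, `E`, `E`, `Q`
respectively, produce all the zero and identity blocks; `E₁₁` and `E₂₂` even become identities.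

The substantial point is that `A₁₁` is invertible, that is, zero is a semisimple eigenvalue of the
compressed pencil on `D`. This is where dissipativity of `L` and positivity of `Eᴴ Q` enter
(`mem_coreKer_of_orthogonal`). The basis of `W₁` is still free, so a Schur form, or real Schur form,
of the compression of `L Q E⁻¹` to `W₁` makes `A₁₁` triangular. -/

theorem Orthonormal.sumElim {𝕜 H ι κ : Type*} [RCLike 𝕜] [NormedAddCommGroup H]
    [InnerProductSpace 𝕜 H] {v : ι → H} {w : κ → H} (hv : Orthonormal 𝕜 v)
    (hw : Orthonormal 𝕜 w) (h : ∀ i j, inner 𝕜 (v i) (w j) = 0) :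
    Orthonormal 𝕜 (Sum.elim v w) := by
  refine ⟨?_, ?_⟩
  · rintro (i | i)
    · exact hv.1 i
    · exact hw.1 i
  · rintro (i | i) (j | j) hij
    · exact hv.2 fun e => hij (congrArg _ e)
    · exact h i j
    · exact inner_eq_zero_symm.1 (h j i)
    · exact hw.2 fun e => hij (congrArg _ e)

theorem OrthonormalBasis.mem_orthogonal_of_forall {𝕜 H ι : Type*} [RCLike 𝕜]
    [NormedAddCommGroup H] [InnerProductSpace 𝕜 H] [Fintype ι] {K : Submodule 𝕜 H}
    (b : OrthonormalBasis ι 𝕜 K) {x : H} (h : ∀ i, inner 𝕜 (b i : H) x = 0) : x ∈ Kᗮ := by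
  rw [Submodule.mem_orthogonal]
  intro u hu
  have := congrArg (Subtype.val) (b.sum_repr ⟨u, hu⟩)
  simp only [Submodule.coe_sum, Submodule.coe_smul] at this
  rw [← this, sum_inner]
  exact Finset.sum_eq_zero fun i _ => by rw [inner_smul_left, h, mul_zero]

theorem OrthonormalBasis.orthonormal_coe {𝕜 H ι : Type*} [RCLike 𝕜]
    [NormedAddCommGroup H] [InnerProductSpace 𝕜 H] [Fintype ι] {K : Submodule 𝕜 H}
    (b : OrthonormalBasis ι 𝕜 K) : Orthonormal 𝕜 fun i => (b i : H) :=
  b.orthonormal.comp_linearIsometry K.subtypeₗᵢ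

universe u

/-- If every endomorphism of a nonzero space has a nonzero invariant subspace of dimension at
most `d`, then every endomorphism is represented with respect to some orthonormal basis by a
lower block triangular matrix with diagonal blocks of size at most `d`. -/
theorem exists_orthonormalBasis_lower_blockTriangular {𝕜 : Type*} [RCLike 𝕜] (d : ℕ)
    (hd : ∀ (V : Type u) [NormedAddCommGroup V] [InnerProductSpace 𝕜 V] [FiniteDimensional 𝕜 V]
      [Nontrivial V] (T : V →ₗ[𝕜] V), ∃ S : Submodule 𝕜 V, S ≠ ⊥ ∧ Module.finrank 𝕜 S ≤ d ∧
        ∀ x ∈ S, T x ∈ S) (m : ℕ) :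
    ∀ (V : Type u) [NormedAddCommGroup V] [InnerProductSpace 𝕜 V] [FiniteDimensional 𝕜 V]
      (T : V →ₗ[𝕜] V), Module.finrank 𝕜 V = m →
      ∃ (b : OrthonormalBasis (Fin m) 𝕜 V) (β : Fin m → ℕ), Monotone β ∧
        (∀ t, (Finset.univ.filter fun i => β i = t).card ≤ d) ∧
        ∀ i j, β i < β j → inner 𝕜 (b i) (T (b j)) = 0 := by
  induction m using Nat.strong_induction_on with
  | _ m ih =>
  intro V _ _ _ T hm
  rcases Nat.eq_zero_or_pos m with rfl | hpos
  · exact ⟨(stdOrthonormalBasis 𝕜 V).reindex (finCongr hm), fun _ => 0, fun _ _ _ => le_rfl,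
      fun t => by simp, fun i => i.elim0⟩
  have : Nontrivial V := Module.nontrivial_of_finrank_pos (R := 𝕜) (hm ▸ hpos)
  -- The invariant subspace is taken for the adjoint, so that `Sᗮ` is invariant under `T`; listing
  -- `S` before `Sᗮ` then makes the upper right block vanish.
  obtain ⟨S, hS, hSd, hST⟩ := hd V (LinearMap.adjoint T)
  have hk : 0 < Module.finrank 𝕜 S :=
    Nat.pos_of_ne_zero fun h => hS (Submodule.finrank_eq_zero.1 h)
  have hsum := S.finrank_add_finrank_orthogonal
  have hinv : ∀ x ∈ Sᗮ, T x ∈ Sᗮ := by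
    intro x hx
    rw [Submodule.mem_orthogonal]
    intro u hu
    rw [← LinearMap.adjoint_inner_left]
    exact (Submodule.mem_orthogonal _ _).1 hx _ (hST u hu)
  obtain ⟨b', β', hmono, hcard, htri⟩ :=
    ih (Module.finrank 𝕜 Sᗮ) (by omega) Sᗮ (T.restrict hinv) rfl
  set b₀ := stdOrthonormalBasis 𝕜 S
  obtain rfl : Module.finrank 𝕜 S + Module.finrank 𝕜 Sᗮ = m := hsum.trans hm
  have hon : Orthonormal 𝕜 (Sum.elim (fun i => (b₀ i : V)) fun i => (b' i : V)) :=
    b₀.orthonormal_coe.sumElim b'.orthonormal_coe fun i j =>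
      (Submodule.mem_orthogonal _ _).1 (b' j).2 _ (b₀ i).2
  have hbot : (Submodule.span 𝕜 (Set.range (Sum.elim (fun i => (b₀ i : V))
      fun i => (b' i : V))))ᗮ = ⊥ := by
    rw [eq_bot_iff]
    intro x hx
    have hx' : ∀ s, inner 𝕜 (Sum.elim (fun i => (b₀ i : V)) (fun i => (b' i : V)) s) x = 0 :=
      fun s => (Submodule.mem_orthogonal _ _).1 hx _ (Submodule.subset_span ⟨s, rfl⟩)
    have h1 : x ∈ Sᗮ := b₀.mem_orthogonal_of_forall fun i => hx' (Sum.inl i)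
    have h2 : x ∈ Sᗮᗮ := b'.mem_orthogonal_of_forall fun i => hx' (Sum.inr i)
    exact inner_self_eq_zero.1 ((Submodule.mem_orthogonal _ _).1 h2 _ h1)
  -- The vectors of `S` form block `0`; the block labels coming from `Sᗮ` are shifted by one.
  refine ⟨(OrthonormalBasis.mkOfOrthogonalEqBot hon hbot).reindex finSumFinEquiv,
    Fin.addCases (fun _ => 0) (fun i => β' i + 1), ?_, ?_, ?_⟩
  · intro i j hij
    induction i using Fin.addCases with
    | left i => simp
    | right i =>
      induction j using Fin.addCases with
      | left j =>
        have := i.2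
        have := j.2
        simp only [Fin.le_def, Fin.val_natAdd, Fin.val_castAdd] at hij
        omega
      | right j =>
        simpa using hmono ((Fin.natAdd_le_natAdd_iff _).1 hij)
  · intro t
    rw [Finset.card_filter, Fin.sum_univ_add]
    rcases t with _ | t
    · simpa using hSd
    · have := hcard t
      rw [Finset.card_filter] at this
      simpa using this
  · intro i j hij
    induction j using Fin.addCases with
    | left j => simp at hij
    | right j =>
      have hTj : T (b' j) ∈ Sᗮ := hinv _ (b' j).2
      induction i using Fin.addCases with
      | left i =>
        simpa using (Submodule.mem_orthogonal _ _).1 hTj _ (b₀ i).2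
      | right i =>
        have := htri i j (by simpa using hij)
        simpa using this

theorem exists_invariant_finrank_le_one (V : Type u) [NormedAddCommGroup V]
    [InnerProductSpace ℂ V] [FiniteDimensional ℂ V] [Nontrivial V] (T : V →ₗ[ℂ] V) :
    ∃ S : Submodule ℂ V, S ≠ ⊥ ∧ Module.finrank ℂ S ≤ 1 ∧ ∀ x ∈ S, T x ∈ S := by
  obtain ⟨μ, hμ⟩ := Module.End.exists_eigenvalue T
  obtain ⟨v, hv⟩ := hμ.exists_hasEigenvector
  refine ⟨Submodule.span ℂ {v}, ?_, ?_, ?_⟩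
  · simpa using hv.2
  · exact (finrank_span_singleton hv.2).le
  · intro x hx
    obtain ⟨a, rfl⟩ := Submodule.mem_span_singleton.1 hx
    rw [map_smul, hv.apply_eq_smul]
    exact Submodule.smul_mem _ _ (Submodule.smul_mem _ _ (Submodule.mem_span_singleton_self v))

-- An irreducible factor `p` of the minimal polynomial has degree at most two over `ℝ`. The cofactor
-- `q` does not annihilate `T`, so some `v = q(T) w` is nonzero, and `p(T) v = 0` makes the span of
-- `v` and `T v` invariant.
open Polynomial in
theorem exists_invariant_finrank_le_two (V : Type u) [NormedAddCommGroup V]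
    [InnerProductSpace ℝ V] [FiniteDimensional ℝ V] [Nontrivial V] (T : V →ₗ[ℝ] V) :
    ∃ S : Submodule ℝ V, S ≠ ⊥ ∧ Module.finrank ℝ S ≤ 2 ∧ ∀ x ∈ S, T x ∈ S := by
  have hint : IsIntegral ℝ T := Algebra.IsIntegral.isIntegral T
  obtain ⟨p, hp, q, hq⟩ := WfDvdMonoid.exists_irreducible_factor (minpoly.not_isUnit ℝ T)
    (minpoly.ne_zero hint)
  have hq0 : q ≠ 0 := by
    rintro rfl
    exact minpoly.ne_zero hint (by simpa using hq)
  have hqT : aeval T q ≠ 0 := by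
    intro h
    have h1 := Polynomial.natDegree_le_of_dvd (minpoly.dvd ℝ T h) hq0
    rw [hq, natDegree_mul hp.ne_zero hq0] at h1
    have := hp.natDegree_pos
    omega
  obtain ⟨w, hw⟩ : ∃ w, aeval T q w ≠ 0 := by
    by_contra! h
    exact hqT (LinearMap.ext h)
  set v := aeval T q w with hv
  have hpv : aeval T p v = 0 := by
    have h := minpoly.aeval ℝ T
    rw [hq, map_mul] at h
    exact LinearMap.congr_fun h w
  have hsum : p.coeff 0 • v + p.coeff 1 • T v + p.coeff 2 • T (T v) = 0 := by
    have h := aeval_eq_sum_range' (Nat.lt_succ_of_le hp.natDegree_le_two) T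
    rw [h] at hpv
    simpa [Finset.sum_range_succ, pow_two] using hpv
  obtain ⟨a, b, hab⟩ : ∃ a b : ℝ, T (T v) = a • v + b • T v := by
    by_cases h2 : p.coeff 2 = 0
    · have h1 : p.coeff 1 ≠ 0 := by
        have hpos := hp.natDegree_pos
        have hlead : p.coeff p.natDegree ≠ 0 := leadingCoeff_ne_zero.2 hp.ne_zero
        have hle := hp.natDegree_le_two
        interval_cases p.natDegree
        · exact hlead
        · exact absurd h2 hlead
      have hTv : T v = (-(p.coeff 0 / p.coeff 1)) • v := by
        rw [h2, zero_smul, add_zero] at hsum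
        have h := congrArg (fun x => (p.coeff 1)⁻¹ • x) hsum
        simp only [smul_add, smul_smul, inv_mul_cancel₀ h1, one_smul, smul_zero] at h
        rw [eq_neg_of_add_eq_zero_right h, ← neg_smul, div_eq_inv_mul]
      refine ⟨0, -(p.coeff 0 / p.coeff 1), ?_⟩
      rw [zero_smul, zero_add]
      conv_lhs => rw [hTv]
      rw [map_smul]
    · refine ⟨-(p.coeff 0 / p.coeff 2), -(p.coeff 1 / p.coeff 2), ?_⟩
      have h := congrArg (fun x => (p.coeff 2)⁻¹ • x) hsum
      simp only [smul_add, smul_smul, inv_mul_cancel₀ h2, one_smul, smul_zero] at h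
      rw [eq_neg_of_add_eq_zero_right h, neg_add, ← neg_smul, ← neg_smul, div_eq_inv_mul,
        div_eq_inv_mul]
  refine ⟨Submodule.span ℝ {v, T v}, ?_, ?_, ?_⟩
  · intro h
    exact hw ((Submodule.span_eq_bot.1 h) v (by simp))
  · classical
    have h := finrank_span_finset_le_card (R := ℝ) {v, T v}
    have h2 := Finset.card_le_two (a := v) (b := T v)
    simp only [Finset.coe_insert, Finset.coe_singleton] at h
    exact h.trans h2
  · intro x hx
    obtain ⟨s, t, rfl⟩ := Submodule.mem_span_pair.1 hx
    rw [map_add, map_smul, map_smul, hab]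
    have h1 : v ∈ Submodule.span ℝ {v, T v} := Submodule.subset_span (by simp)
    have h2 : T v ∈ Submodule.span ℝ {v, T v} := Submodule.subset_span (by simp)
    exact add_mem (Submodule.smul_mem _ _ h2) (Submodule.smul_mem _ _
      (add_mem (Submodule.smul_mem _ _ h1) (Submodule.smul_mem _ _ h2)))

/-! ### Regular pencils of index at most one -/

theorem Fin.sum_ite_val_eq_mul {R : Type*} [NonAssocSemiring R] {m : ℕ} (f : Fin m → R) {a : ℕ}
    (ha : a < m) : ∑ k : Fin m, (if a = (k : ℕ) then (1 : R) else 0) * f k = f ⟨a, ha⟩ := by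
  rw [Finset.sum_eq_single ⟨a, ha⟩]
  · simp
  · intro k _ hk
    rw [if_neg fun e => hk (Fin.ext e.symm), zero_mul]
  · simp

/-- Since the kernel is nonzero for every `z`, such a block cannot occur in a regular pencil. -/
theorem KroneckerBlock.exists_mulVec_eq_zero_of_right (ε : ℕ) (z : ℂ) :
    ∃ v : Fin (KroneckerBlock.right ε).cols → ℂ, v ≠ 0 ∧
      (z • (KroneckerBlock.right ε).coeffE - (KroneckerBlock.right ε).coeffA) *ᵥ v = 0 := by
  refine ⟨fun j => z ^ (j : ℕ), fun h => ?_, ?_⟩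
  · have : z ^ 0 = 0 := congrFun h (⟨0, Nat.succ_pos ε⟩ : Fin (ε + 1))
    simp at this
  · ext i
    have hi : (i : ℕ) < ε := i.2
    have h1 := Fin.sum_ite_val_eq_mul (fun j : Fin (ε + 1) => z ^ (j : ℕ))
      (Nat.lt_succ_of_lt hi)
    have h2 := Fin.sum_ite_val_eq_mul (fun j : Fin (ε + 1) => z ^ (j : ℕ))
      (Nat.succ_lt_succ hi)
    rw [sub_mulVec, smul_mulVec]
    change z * (∑ j : Fin (ε + 1), (if (j : ℕ) = (i : ℕ) then (1 : ℂ) else 0) * z ^ (j : ℕ))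
      - ∑ j : Fin (ε + 1), (if (j : ℕ) = (i : ℕ) + 1 then (1 : ℂ) else 0) * z ^ (j : ℕ) = 0
    simp only [eq_comm (b := (i : ℕ)), eq_comm (b := (i : ℕ) + 1)]
    rw [h1, h2, pow_succ', sub_self]

/-- A block other than `right ε` and `nilp σ`, `σ ≥ 2`, has no chain of length two at infinity. -/
theorem KroneckerBlock.eq_zero_of_chain (b : KroneckerBlock) (hb : ∀ ε, b ≠ right ε)
    (hσ : b.nilpSize ≤ 1) {x y : Fin b.cols → ℂ} (hx : b.coeffE *ᵥ x = 0)
    (hxy : b.coeffA *ᵥ x = b.coeffE *ᵥ y) : x = 0 := by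
  cases b with
  | right ε => exact absurd rfl (hb ε)
  -- For `left` and `jordan` blocks the coefficient of `E` is already injective, so only `E x = 0`
  -- is needed; in particular `left` blocks need not be excluded.
  | left η =>
    ext j
    have h := congrFun hx (⟨j, Nat.lt_succ_of_lt j.2⟩ : Fin (η + 1))
    exact (Fin.sum_ite_val_eq_mul (R := ℂ) (m := η) x j.2).symm.trans h
  | jordan ρ μ =>
    ext j
    exact (Fin.sum_ite_val_eq_mul (R := ℂ) (m := ρ) x j.2).symm.trans (congrFun hx j)
  -- Here `σ = 1`: the coefficient of `E` is zero and that of `A` is the identity.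
  | nilp σ =>
    have hσ' : (σ : ℕ) ≤ 1 := hσ
    ext j
    refine (Fin.sum_ite_val_eq_mul (R := ℂ) (m := σ) x j.2).symm.trans ((congrFun hxy j).trans ?_)
    have hE : (nilp σ).coeffE = 0 := by
      ext i k
      have hk : (k : ℕ) < σ := k.2
      exact if_neg (by omega)
    rw [hE, zero_mulVec]
    rfl

theorem Matrix.blockDiagonal'_mulVec_apply {R o : Type*} {m n : o → Type*} [CommSemiring R]
    [Fintype o] [DecidableEq o] [∀ i, Fintype (n i)] (M : ∀ i, Matrix (m i) (n i) R)
    (x : (Σ i, n i) → R) (i : o) (a : m i) :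
    (blockDiagonal' M *ᵥ x) ⟨i, a⟩ = (M i *ᵥ fun c => x ⟨i, c⟩) a := by
  rw [mulVec, dotProduct, Fintype.sum_sigma, Finset.sum_eq_single i]
  · simp [mulVec, dotProduct]
  · intro j _ hj
    simp [blockDiagonal'_apply_ne _ _ _ hj.symm]
  · simp

/-- A regular pencil of index at most one has no chain of length two at infinity. -/
theorem eq_zero_of_isRegularPencil_of_hasIndex {n : ℕ} {E A : Matrix (Fin n) (Fin n) ℂ}
    (hreg : IsRegularPencil E A) (hind : ∃ ν, HasIndex E A ν ∧ ν ≤ 1) {x y : Fin n → ℂ}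
    (hx : E *ᵥ x = 0) (hxy : A *ᵥ x = E *ᵥ y) : x = 0 := by
  obtain ⟨ν, ⟨k, b, ⟨r, c, S, T, hS, hT, hE, hA⟩, rfl⟩, hν⟩ := hind
  have hTdet : IsUnit T.det := (isUnit_iff_isUnit_det T).1 hT
  have key : ∀ (M : Matrix (Fin n) (Fin n) ℂ) (v : Fin n → ℂ),
      (S * M * T).submatrix r c *ᵥ (v ∘ c) = (S *ᵥ (M *ᵥ (T *ᵥ v))) ∘ r := by
    intro M v
    rw [submatrix_mulVec_equiv, mulVec_mulVec, mulVec_mulVec, Matrix.mul_assoc]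
    simp [Function.comp_assoc]
  have hσ : ∀ i, (b i).nilpSize ≤ 1 := fun i =>
    (Finset.le_sup (f := fun i => (b i).nilpSize) (Finset.mem_univ i)).trans hν
  have hright : ∀ i ε, b i ≠ KroneckerBlock.right ε := by
    intro i ε hi
    obtain ⟨z, hz⟩ := hreg
    obtain ⟨v, hv0, hv⟩ : ∃ v : Fin (b i).cols → ℂ, v ≠ 0 ∧
        (z • (b i).coeffE - (b i).coeffA) *ᵥ v = 0 := by
      rw [hi]
      exact KroneckerBlock.exists_mulVec_eq_zero_of_right ε z
    -- The kernel vector of the `i`-th block, extended by zero, is a kernel vector of the whole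
    -- pencil at a point where the pencil is invertible.
    set V : (Σ i, Fin (b i).cols) → ℂ := fun s =>
      if h : s.1 = i then v (h ▸ s.2) else 0 with hV
    have hVi : (fun a => V ⟨i, a⟩) = v := by
      ext a
      simp [hV]
    have hVj : ∀ j, j ≠ i → (fun a => V ⟨j, a⟩) = 0 := by
      intro j hj
      ext a
      simp [hV, hj]
    have hzero : (S * (z • E - A) * T).submatrix r c *ᵥ V = 0 := by
      have : (S * (z • E - A) * T).submatrix r c =
          z • (S * E * T).submatrix r c - (S * A * T).submatrix r c := by
        rw [Matrix.mul_sub, Matrix.sub_mul, Matrix.mul_smul, Matrix.smul_mul]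
        rfl
      rw [this, hE, hA, sub_mulVec, smul_mulVec]
      ext ⟨j, a⟩
      simp only [Pi.sub_apply, Pi.smul_apply, blockDiagonal'_mulVec_apply, Pi.zero_apply]
      by_cases hj : j = i
      · subst hj
        rw [hVi]
        have := congrFun hv a
        rwa [sub_mulVec, smul_mulVec] at this
      · rw [hVj j hj]
        simp
    have h1 := key (z • E - A) (V ∘ c.symm)
    rw [Function.comp_assoc, Equiv.symm_comp_self, Function.comp_id, hzero] at h1
    have h2 : S *ᵥ ((z • E - A) *ᵥ (T *ᵥ (V ∘ c.symm))) = 0 := by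
      ext a
      simpa using (congrFun h1 (r.symm a)).symm
    have h3 := mulVec_injective_of_isUnit hS (h2.trans (mulVec_zero S).symm)
    have hu : IsUnit (z • E - A) := (isUnit_iff_isUnit_det _).2 (isUnit_iff_ne_zero.2 hz)
    have h4 := mulVec_injective_of_isUnit hu (h3.trans (mulVec_zero _).symm)
    have h5 := mulVec_injective_of_isUnit hT (h4.trans (mulVec_zero _).symm)
    apply hv0
    rw [← hVi]
    ext a
    simpa using congrFun h5 (c ⟨i, a⟩)
  set x' := T⁻¹ *ᵥ x with hx'
  set y' := T⁻¹ *ᵥ y with hy'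
  have hTx : T *ᵥ x' = x := by rw [hx', mulVec_mulVec, mul_nonsing_inv _ hTdet, one_mulVec]
  have hTy : T *ᵥ y' = y := by rw [hy', mulVec_mulVec, mul_nonsing_inv _ hTdet, one_mulVec]
  have hEx := key E x'
  have hEy := key E y'
  have hAx := key A x'
  rw [hE, hTx, hx, mulVec_zero] at hEx
  rw [hE, hTy] at hEy
  rw [hA, hTx, hxy, ← hEy] at hAx
  suffices x' = 0 by rw [← hTx, this, mulVec_zero]
  have hblock : ∀ i, (fun a => (x' ∘ c) ⟨i, a⟩) = 0 := by
    intro i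
    refine (b i).eq_zero_of_chain (hright i) (hσ i) (y := fun a => (y' ∘ c) ⟨i, a⟩) ?_ ?_
    · ext a
      simpa [blockDiagonal'_mulVec_apply] using congrFun hEx ⟨i, a⟩
    · ext a
      simpa [blockDiagonal'_mulVec_apply] using congrFun hAx ⟨i, a⟩
  ext a
  obtain ⟨⟨i, s⟩, rfl⟩ := c.surjective a
  exact congrFun (hblock i) s

/-! ### Semidefinite forms given by pairs of linear maps -/

section
variable {𝕜 H : Type*} [RCLike 𝕜] [NormedAddCommGroup H] [InnerProductSpace 𝕜 H]

/-- A vector on which the real part of a semidefinite sesquilinear form vanishes lies in the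
kernel of its Hermitian part. -/
theorem re_inner_add_re_inner_eq_zero {S T : H →ₗ[𝕜] H}
    (h : ∀ x, 0 ≤ RCLike.re (inner 𝕜 (S x) (T x))) {y : H}
    (hy : RCLike.re (inner 𝕜 (S y) (T y)) = 0) (u : H) :
    RCLike.re (inner 𝕜 (S y) (T u)) + RCLike.re (inner 𝕜 (S u) (T y)) = 0 := by
  set c := RCLike.re (inner 𝕜 (S y) (T u)) + RCLike.re (inner 𝕜 (S u) (T y)) with hc
  set q := RCLike.re (inner 𝕜 (S u) (T u)) with hq
  have hq0 : 0 ≤ q := h u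
  have key : ∀ t : ℝ, 0 ≤ t * c + t ^ 2 * q := by
    intro t
    have h1 := h (y + (t : 𝕜) • u)
    simp only [map_add, map_smul, inner_add_left, inner_add_right, inner_smul_left,
      inner_smul_right, RCLike.conj_ofReal, RCLike.re_ofReal_mul, hy] at h1
    rw [hc, hq]
    linarith
  by_contra hne
  -- A near-minimizer of `t * c + t ^ 2 * q`; the denominator `q + 1` also covers `q = 0`, and the
  -- value is negative unless `c = 0`.
  have h1 := key (-c / (q + 1))
  have h2 : -c / (q + 1) * c + (-c / (q + 1)) ^ 2 * q = -(c ^ 2 / (q + 1) ^ 2) := by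
    field_simp
    ring
  rw [h2] at h1
  have : 0 < c ^ 2 / (q + 1) ^ 2 := by positivity
  linarith

end

/-! ### The condensed form in terms of linear maps -/

/-- The pencil `λ E - L Q` of linear maps: `E^* Q` is positive semidefinite, `L` is dissipative,
and the pencil has no chain of length two at infinity. -/
structure DissipativePencil {𝕜 H : Type*} [RCLike 𝕜] [NormedAddCommGroup H]
    [InnerProductSpace 𝕜 H] (E Q L : H →ₗ[𝕜] H) : Prop where
  symm : ∀ x y, inner 𝕜 (E x) (Q y) = inner 𝕜 (Q x) (E y)
  nonneg : ∀ x, 0 ≤ RCLike.re (inner 𝕜 (E x) (Q x))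
  dissipative : ∀ x, RCLike.re (inner 𝕜 (L x) x) ≤ 0
  eq_zero : ∀ x y, E x = 0 → L (Q x) = E y → x = 0

namespace DissipativePencil

variable {𝕜 H : Type*} [RCLike 𝕜] [NormedAddCommGroup H] [InnerProductSpace 𝕜 H]
  {E Q L : H →ₗ[𝕜] H}

theorem eq_zero_of_ker (h : DissipativePencil E Q L) {x : H} (hE : E x = 0) (hQ : Q x = 0) :
    x = 0 :=
  h.eq_zero x 0 hE (by rw [hQ, map_zero, map_zero])

/-- Cauchy–Schwarz for the positive semidefinite form `⟨E x, Q y⟩`: an isotropic vector lies in its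
radical. Symmetry makes the two real parts equal, and scaling `u` by the conjugate of the inner
product passes from the real part to the full value. -/
theorem inner_eq_zero_of_re (h : DissipativePencil E Q L) {y : H}
    (hy : RCLike.re (inner 𝕜 (E y) (Q y)) = 0) (u : H) : inner 𝕜 (E y) (Q u) = 0 := by
  have key : ∀ u, RCLike.re (inner 𝕜 (E y) (Q u)) = 0 := by
    intro u
    have h1 := re_inner_add_re_inner_eq_zero h.nonneg hy u
    rw [h.symm u y, ← inner_conj_symm (Q u) (E y), RCLike.conj_re] at h1
    linarith
  have h1 := key ((starRingEnd 𝕜 (inner 𝕜 (E y) (Q u))) • u)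
  rw [map_smul, inner_smul_right, RCLike.conj_mul] at h1
  have h2 : ‖inner 𝕜 (E y) (Q u)‖ ^ 2 = 0 := by exact_mod_cast h1
  exact norm_eq_zero.1 (pow_eq_zero_iff two_ne_zero |>.1 h2)

/-- `L` is not Hermitian, so one-sided vanishing does not transfer by symmetry alone. It does make
`y` isotropic for the semidefinite form `-Re ⟨L Q x, Q x⟩`, and then the Hermitian part vanishes
against `y`. -/
theorem re_inner_eq_zero_of_forall (h : DissipativePencil E Q L) {y : H}
    (hy : ∀ u, inner 𝕜 (L (Q y)) (Q u) = 0) (u : H) :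
    RCLike.re (inner 𝕜 (L (Q u)) (Q y)) = 0 := by
  have h1 := re_inner_add_re_inner_eq_zero (S := -(L ∘ₗ Q)) (T := Q)
    (fun x => by simpa using h.dissipative (Q x)) (y := y) (by simp [hy]) u
  simpa [hy] using h1

variable (E Q) in
/-- The intersection of the ranges of `E` and `Q`. -/
def core : Submodule 𝕜 H := LinearMap.range E ⊓ LinearMap.range Q

variable (E Q L) in
/-- The vectors which `E` maps into the range of `Q` and `L Q` into the range of `E`. -/
def coreDomain : Submodule 𝕜 H :=
  (LinearMap.range Q).comap E ⊓ (LinearMap.range E).comap (L ∘ₗ Q)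

theorem mem_coreDomain {x : H} :
    x ∈ coreDomain E Q L ↔ E x ∈ LinearMap.range Q ∧ L (Q x) ∈ LinearMap.range E := Iff.rfl

variable (E Q L) in
/-- The vectors of `coreDomain E Q L` which `L Q` maps into the orthogonal complement of
`core E Q`. -/
def coreKer : Submodule 𝕜 H := coreDomain E Q L ⊓ ((core E Q)ᗮ).comap (L ∘ₗ Q)

theorem mem_coreKer {x : H} :
    x ∈ coreKer E Q L ↔ x ∈ coreDomain E Q L ∧ L (Q x) ∈ (core E Q)ᗮ := Iff.rfl

theorem mem_core_of_mem_coreDomain {x : H} (hx : x ∈ coreDomain E Q L) : E x ∈ core E Q :=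
  ⟨⟨x, rfl⟩, hx.1⟩

theorem eq_zero_of_mem_coreDomain (h : DissipativePencil E Q L) {x : H}
    (hx : x ∈ coreDomain E Q L) (hE : E x = 0) : x = 0 := by
  obtain ⟨y, hy⟩ := hx.2
  exact h.eq_zero x y hE hy.symm

variable [FiniteDimensional 𝕜 H]

/-- Symmetry gives the inclusion; `T` is injective on `ker S`, whose dimension is the codimension of
`ran S`. -/
theorem _root_.LinearMap.map_ker_eq_orthogonal_range {S T : H →ₗ[𝕜] H}
    (hsymm : ∀ x y, inner 𝕜 (S x) (T y) = inner 𝕜 (T x) (S y))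
    (h0 : ∀ x, S x = 0 → T x = 0 → x = 0) :
    (LinearMap.ker S).map T = (LinearMap.range S)ᗮ := by
  apply Submodule.eq_of_le_of_finrank_eq
  · rintro _ ⟨x, hx, rfl⟩
    rw [Submodule.mem_orthogonal]
    rintro _ ⟨y, rfl⟩
    rw [hsymm, LinearMap.mem_ker.1 hx, inner_zero_right]
  · have h1 : Module.finrank 𝕜 ((LinearMap.ker S).map T) =
        Module.finrank 𝕜 (LinearMap.ker S) := by
      rw [← LinearMap.range_domRestrict]
      apply LinearMap.finrank_range_of_inj
      rw [injective_iff_map_eq_zero]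
      exact fun x hx => Subtype.ext (h0 x x.2 hx)
    have h2 := LinearMap.finrank_range_add_finrank_ker S
    have h3 := (LinearMap.range S).finrank_add_finrank_orthogonal
    omega

/-- In finite dimension `(A ⊓ B)ᗮ = Aᗮ ⊔ Bᗮ`; as `Bᗮ ≤ A`, the `Aᗮ` component of `v` also lies in
`A` and so vanishes. -/
theorem _root_.Submodule.mem_orthogonal_of_orthogonal_le {A B : Submodule 𝕜 H} (hle : Bᗮ ≤ A)
    {v : H} (hv : v ∈ A) (hv' : v ∈ (A ⊓ B)ᗮ) : v ∈ Bᗮ := by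
  have hsup : (A ⊓ B)ᗮ = Aᗮ ⊔ Bᗮ := by
    rw [← Submodule.orthogonal_orthogonal (Aᗮ ⊔ Bᗮ), ← Submodule.inf_orthogonal,
      Submodule.orthogonal_orthogonal, Submodule.orthogonal_orthogonal]
  obtain ⟨a, ha, b, hb, rfl⟩ := Submodule.mem_sup.1 (hsup ▸ hv')
  have haA : a ∈ A := by simpa using sub_mem hv (hle hb)
  rw [inner_self_eq_zero.1 ((Submodule.mem_orthogonal _ _).1 ha a haA), zero_add]
  exact hb

theorem map_ker_left (h : DissipativePencil E Q L) :
    (LinearMap.ker E).map Q = (LinearMap.range E)ᗮ :=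
  LinearMap.map_ker_eq_orthogonal_range h.symm fun _ => h.eq_zero_of_ker

theorem map_ker_right (h : DissipativePencil E Q L) :
    (LinearMap.ker Q).map E = (LinearMap.range Q)ᗮ :=
  LinearMap.map_ker_eq_orthogonal_range (fun x y => (h.symm x y).symm)
    fun _ hQ hE => h.eq_zero_of_ker hE hQ

theorem orthogonal_range_le' (h : DissipativePencil E Q L) :
    (LinearMap.range E)ᗮ ≤ LinearMap.range Q := by
  rw [← h.map_ker_left]
  exact LinearMap.map_le_range

theorem orthogonal_range_le (h : DissipativePencil E Q L) :
    (LinearMap.range Q)ᗮ ≤ LinearMap.range E := by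
  rw [← h.map_ker_right]
  exact LinearMap.map_le_range

theorem mem_orthogonal_range (h : DissipativePencil E Q L) {v : H}
    (hv : v ∈ LinearMap.range E) (hv' : v ∈ (core E Q)ᗮ) : v ∈ (LinearMap.range Q)ᗮ :=
  Submodule.mem_orthogonal_of_orthogonal_le h.orthogonal_range_le hv hv'

/-- The space is spanned by the kernel of `E` and the vectors which `L Q` maps into the range
of `E`. -/
theorem exists_sub_mem (h : DissipativePencil E Q L) (x : H) :
    ∃ y, E y = 0 ∧ L (Q (x - y)) ∈ LinearMap.range E := by
  -- The chain condition makes `ran E` and `L Q (ker E)` independent and preserves the dimension of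
  -- `ker E`; by rank–nullity they fill the space.
  have hdisj : Disjoint (LinearMap.range E) ((LinearMap.ker E).map (L ∘ₗ Q)) := by
    rw [Submodule.disjoint_def]
    rintro _ ⟨z, rfl⟩ ⟨y, hy, hyz⟩
    rw [← hyz, h.eq_zero y z hy hyz, map_zero]
  have h1 : Module.finrank 𝕜 ((LinearMap.ker E).map (L ∘ₗ Q)) =
      Module.finrank 𝕜 (LinearMap.ker E) := by
    rw [← LinearMap.range_domRestrict]
    apply LinearMap.finrank_range_of_inj
    rw [injective_iff_map_eq_zero]
    exact fun x hx => Subtype.ext (h.eq_zero x 0 x.2 (hx.trans (map_zero E).symm))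
  have h2 := LinearMap.finrank_range_add_finrank_ker E
  have htop : LinearMap.range E ⊔ (LinearMap.ker E).map (L ∘ₗ Q) = ⊤ :=
    Submodule.eq_top_of_disjoint _ _ (by rw [h1, h2]) hdisj
  have hx : L (Q x) ∈ LinearMap.range E ⊔ (LinearMap.ker E).map (L ∘ₗ Q) :=
    htop ▸ Submodule.mem_top
  obtain ⟨u, hu, _, ⟨y, hy, rfl⟩, huy⟩ := Submodule.mem_sup.1 hx
  refine ⟨y, hy, ?_⟩
  rw [map_sub, map_sub, ← huy]
  simpa using hu

/-- `E` restricts to a bijection from `coreDomain E Q L` onto `core E Q`. -/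
theorem exists_mem_coreDomain (h : DissipativePencil E Q L) {v : H} (hv : v ∈ core E Q) :
    ∃ x ∈ coreDomain E Q L, E x = v := by
  obtain ⟨⟨x, rfl⟩, hv⟩ := hv
  obtain ⟨y, hy, hxy⟩ := h.exists_sub_mem x
  have hE : E (x - y) = E x := by rw [map_sub, hy, sub_zero]
  exact ⟨x - y, mem_coreDomain.2 ⟨by rwa [hE], hxy⟩, hE⟩

/-- The inverse of the restriction of `E` to `coreDomain E Q L`. -/
theorem exists_inverse (h : DissipativePencil E Q L) :
    ∃ G : core E Q →ₗ[𝕜] H, ∀ v, G v ∈ coreDomain E Q L ∧ E (G v) = v := by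
  let f : coreDomain E Q L →ₗ[𝕜] core E Q :=
    (E.domRestrict _).codRestrict _ fun x => mem_core_of_mem_coreDomain x.2
  have hf : Function.Surjective f := fun v => by
    obtain ⟨x, hx, hxv⟩ := h.exists_mem_coreDomain v.2
    exact ⟨⟨x, hx⟩, Subtype.ext hxv⟩
  obtain ⟨g, hg⟩ := f.exists_rightInverse_of_surjective (LinearMap.range_eq_top.2 hf)
  exact ⟨(coreDomain E Q L).subtype ∘ₗ g, fun v =>
    ⟨(g v).2, congrArg Subtype.val (LinearMap.congr_fun hg v)⟩⟩

/-- The eigenvalue zero of the restricted pencil is semisimple. -/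
theorem mem_coreKer_of_orthogonal (h : DissipativePencil E Q L) {x : H}
    (hx : x ∈ coreDomain E Q L)
    (hort : L (Q x) ∈ (core E Q ⊓ ((coreKer E Q L).map E)ᗮ)ᗮ) : x ∈ coreKer E Q L := by
  set W := (coreKer E Q L).map E with hW
  have hWcore : W ≤ core E Q := by
    rintro _ ⟨y, hy, rfl⟩
    exact mem_core_of_mem_coreDomain hy.1
  -- The aim is `a = 0`: the remainder `z` is orthogonal to `W` and, by `hort`, to the rest of the
  -- core.
  obtain ⟨a, ha, z, hz, haz⟩ := W.exists_add_mem_mem_orthogonal (L (Q x))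
  have hzcore : z ∈ (core E Q)ᗮ := by
    rw [Submodule.mem_orthogonal]
    intro c hc
    obtain ⟨c₁, hc₁, c₂, hc₂, rfl⟩ := W.exists_add_mem_mem_orthogonal c
    have hc₂' : c₂ ∈ core E Q := by
      simpa using sub_mem hc (hWcore hc₁)
    have h1 := (Submodule.mem_orthogonal _ _).1 hort c₂ ⟨hc₂', hc₂⟩
    rw [haz, inner_add_right, inner_eq_zero_symm.1 ((Submodule.mem_orthogonal _ _).1 hc₂ a ha),
      zero_add] at h1
    rw [inner_add_left, h1, (Submodule.mem_orthogonal _ _).1 hz c₁ hc₁, add_zero]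
  have hzE : z ∈ LinearMap.range E := by
    simpa [haz] using sub_mem (mem_coreDomain.1 hx).2 (hWcore ha).1
  have hzQ := h.mem_orthogonal_range hzE hzcore
  obtain ⟨y, hy, rfl⟩ := ha
  have hyQ : ∀ u, inner 𝕜 (L (Q y)) (Q u) = 0 := fun u => inner_eq_zero_symm.1
    ((Submodule.mem_orthogonal _ _).1 (h.mem_orthogonal_range hy.1.2 hy.2) _ ⟨u, rfl⟩)
  -- With `L Q x = E y + z` and `z` orthogonal to `ran Q`, dissipativity yields `Re ⟨E y, Q y⟩ = 0`.
  -- By positivity `E y` is then orthogonal to `ran Q`, which contains it.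
  have h1 := h.re_inner_eq_zero_of_forall hyQ x
  rw [haz, inner_add_left, inner_eq_zero_symm.1 ((Submodule.mem_orthogonal _ _).1 hzQ _ ⟨y, rfl⟩),
    add_zero] at h1
  have h2 : E y ∈ (LinearMap.range Q)ᗮ := by
    rw [Submodule.mem_orthogonal']
    rintro _ ⟨u, rfl⟩
    exact h.inner_eq_zero_of_re h1 u
  have h3 : E y = 0 :=
    inner_self_eq_zero.1 ((Submodule.mem_orthogonal _ _).1 h2 _ hy.1.1)
  rw [h3, zero_add] at haz
  exact mem_coreKer.2 ⟨hx, haz ▸ hzcore⟩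

/-- This is the invertibility of the leading block of `Q`. The hypotheses put `Q v` in `(ran E)ᗮ = Q
(ker E)`, so `v` differs from an element of `ker E` by one of `ker Q`; then `E v` lies in `E (ker Q)
= (ran Q)ᗮ` as well as in `ran Q`. -/
theorem eq_zero_of_Q_orthogonal (h : DissipativePencil E Q L) {v : H}
    (hv : v ∈ coreDomain E Q L) (hort : Q v ∈ (core E Q)ᗮ) : v = 0 := by
  have h1 : Q v ∈ (LinearMap.range E)ᗮ :=
    Submodule.mem_orthogonal_of_orthogonal_le h.orthogonal_range_le' ⟨v, rfl⟩
      (inf_comm (LinearMap.range E) _ ▸ hort)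
  rw [← h.map_ker_left] at h1
  obtain ⟨y, hy, hyv⟩ := h1
  have h2 : E v ∈ (LinearMap.range Q)ᗮ := by
    rw [← h.map_ker_right]
    refine ⟨v - y, ?_, ?_⟩
    · simp [hyv]
    · rw [map_sub, LinearMap.mem_ker.1 hy, sub_zero]
  exact h.eq_zero_of_mem_coreDomain hv
    (inner_self_eq_zero.1 ((Submodule.mem_orthogonal _ _).1 h2 _ hv.1))

end DissipativePencil

/-! ### Bases adapted to the condensed form -/

/-- A kernel vector of this square matrix is the coefficient vector of some `v ∈ K` with `M v`
orthogonal to every `w i`. All invertible blocks other than those of `E` are obtained this way. -/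
theorem Matrix.isUnit_of_inner_apply {𝕜 H ι : Type*} [RCLike 𝕜] [NormedAddCommGroup H]
    [InnerProductSpace 𝕜 H] [Fintype ι] [DecidableEq ι] {x w : ι → H}
    (hx : LinearIndependent 𝕜 x) (K : Submodule 𝕜 H) (hxK : ∀ i, x i ∈ K) (M : H →ₗ[𝕜] H)
    (hM : ∀ v ∈ K, (∀ i, inner 𝕜 (w i) (M v) = 0) → v = 0) :
    IsUnit (Matrix.of fun i j => inner 𝕜 (w i) (M (x j))) := by
  rw [← mulVec_injective_iff_isUnit]
  refine (injective_iff_map_eq_zero (mulVecLin _)).2 fun c hc => ?_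
  have h1 : ∑ j, c j • x j = 0 := by
    refine hM _ (Submodule.sum_mem _ fun j _ => Submodule.smul_mem _ _ (hxK j)) fun i => ?_
    have h2 := congrFun hc i
    rw [map_sum, inner_sum]
    refine Eq.trans (Finset.sum_congr rfl fun j _ => ?_) h2
    rw [map_smul, inner_smul_right, mul_comm]
    rfl
  ext j
  exact Fintype.linearIndependent_iff.1 hx c h1 j

/-- The orthonormal basis `w` and the basis `x`, used for the codomain and the domain
respectively, bring `E`, `Q` and `L Q` to the condensed form. -/
structure IsCondensingBasis {𝕜 H : Type*} [RCLike 𝕜] [NormedAddCommGroup H]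
    [InnerProductSpace 𝕜 H] (E Q L : H →ₗ[𝕜] H)
    (Tri : ∀ {m : ℕ}, Matrix (Fin m) (Fin m) 𝕜 → Prop) {n₁ n₂ n₃ n₄ : ℕ}
    (w : OrthonormalBasis ((Fin n₁ ⊕ Fin n₂) ⊕ (Fin n₃ ⊕ Fin n₄)) 𝕜 H)
    (x : (Fin n₁ ⊕ Fin n₂) ⊕ (Fin n₃ ⊕ Fin n₄) → H) : Prop where
  linearIndependent : LinearIndependent 𝕜 x
  E_inl : ∀ i, E (x (Sum.inl i)) = w (Sum.inl i)
  E_inr_inl : ∀ i, E (x (Sum.inr (Sum.inl i))) = w (Sum.inr (Sum.inl i))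
  E_inr_inr : ∀ i, E (x (Sum.inr (Sum.inr i))) = 0
  Q_inr_inl : ∀ i, Q (x (Sum.inr (Sum.inl i))) = 0
  Q_inr_inr : ∀ i, Q (x (Sum.inr (Sum.inr i))) = w (Sum.inr (Sum.inr i))
  inner_Q : ∀ i y, inner 𝕜 (w (Sum.inr (Sum.inl i))) (Q y) = 0
  inner_inr_inr : ∀ i j, inner 𝕜 (w (Sum.inr (Sum.inr i))) (L (Q (x (Sum.inl j)))) = 0
  inner_inl : ∀ i j, inner 𝕜 (w (Sum.inl i)) (L (Q (x (Sum.inl (Sum.inr j))))) = 0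
  tri : Tri (Matrix.of fun i j =>
    inner 𝕜 (w (Sum.inl (Sum.inl i))) (L (Q (x (Sum.inl (Sum.inl j))))))
  isUnit_A₁₁ : IsUnit (Matrix.of fun i j =>
    inner 𝕜 (w (Sum.inl (Sum.inl i))) (L (Q (x (Sum.inl (Sum.inl j))))))
  isUnit_A₄₄ : IsUnit (Matrix.of fun i j =>
    inner 𝕜 (w (Sum.inr (Sum.inr i))) (L (Q (x (Sum.inr (Sum.inr j))))))
  isUnit_Q : IsUnit (Matrix.of fun i j => inner 𝕜 (w (Sum.inl i)) (Q (x (Sum.inl j))))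

theorem DissipativePencil.exists_isCondensingBasis {𝕜 H : Type*} [RCLike 𝕜]
    [NormedAddCommGroup H] [InnerProductSpace 𝕜 H] [FiniteDimensional 𝕜 H] {E Q L : H →ₗ[𝕜] H}
    (h : DissipativePencil E Q L) (Tri : ∀ {m : ℕ}, Matrix (Fin m) (Fin m) 𝕜 → Prop)
    (hTri : ∀ (W : Submodule 𝕜 H) (T : W →ₗ[𝕜] W),
      ∃ b : OrthonormalBasis (Fin (Module.finrank 𝕜 W)) 𝕜 W,
        Tri (Matrix.of fun i j => inner 𝕜 (b i) (T (b j)))) :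
    ∃ (n₁ n₂ n₃ n₄ : ℕ) (w : OrthonormalBasis ((Fin n₁ ⊕ Fin n₂) ⊕ (Fin n₃ ⊕ Fin n₄)) 𝕜 H)
      (x : (Fin n₁ ⊕ Fin n₂) ⊕ (Fin n₃ ⊕ Fin n₄) → H), IsCondensingBasis E Q L Tri w x := by
  set W₂ := (coreKer E Q L).map E
  set W₁ := core E Q ⊓ W₂ᗮ
  have hW₂core : W₂ ≤ core E Q := by
    rintro _ ⟨y, hy, rfl⟩
    exact mem_core_of_mem_coreDomain hy.1
  obtain ⟨G, hG⟩ := h.exists_inverse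
  -- The endomorphism is the compression to `W₁` of `L Q G`, with `G` inverting `E` on the core;
  -- with `x₁ = G b₁` its matrix is `A₁₁`.
  obtain ⟨b₁, hb₁⟩ := hTri W₁ (W₁.orthogonalProjectionOnto.toLinearMap ∘ₗ L ∘ₗ Q ∘ₗ G ∘ₗ
    Submodule.inclusion inf_le_left)
  set b₂ := stdOrthonormalBasis 𝕜 W₂
  set b₃ := stdOrthonormalBasis 𝕜 (LinearMap.range Q)ᗮ
  set b₄ := stdOrthonormalBasis 𝕜 (LinearMap.range E)ᗮ
  have hx₃ : ∀ i, ∃ y ∈ LinearMap.ker Q, E y = b₃ i := fun i => by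
    exact h.map_ker_right.ge (b₃ i).2
  have hx₄ : ∀ i, ∃ y ∈ LinearMap.ker E, Q y = b₄ i := fun i => by
    exact h.map_ker_left.ge (b₄ i).2
  have hx₂ : ∀ i, ∃ y ∈ coreKer E Q L, E y = b₂ i := fun i => (b₂ i).2
  choose x₃ hx₃Q hx₃E using hx₃
  choose x₄ hx₄E hx₄Q using hx₄
  choose x₂ hx₂K hx₂E using hx₂
  set x₁ : Fin (Module.finrank 𝕜 W₁) → H := fun i => G ⟨b₁ i, (b₁ i).2.1⟩
  have hx₁D : ∀ i, x₁ i ∈ coreDomain E Q L := fun i => (hG _).1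
  have hx₁E : ∀ i, E (x₁ i) = b₁ i := fun i => (hG _).2
  set w₀ := Sum.elim (Sum.elim (fun i => (b₁ i : H)) fun i => (b₂ i : H))
    (Sum.elim (fun i => (b₃ i : H)) fun i => (b₄ i : H)) with hw₀
  set x := Sum.elim (Sum.elim x₁ x₂) (Sum.elim x₃ x₄) with hx
  have hcoreQ : ∀ u ∈ core E Q, ∀ v ∈ (LinearMap.range Q)ᗮ, inner 𝕜 u v = 0 :=
    fun u hu v hv => (Submodule.mem_orthogonal _ _).1 hv u hu.2
  have hcoreE : ∀ u ∈ core E Q, ∀ v ∈ (LinearMap.range E)ᗮ, inner 𝕜 u v = 0 :=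
    fun u hu v hv => (Submodule.mem_orthogonal _ _).1 hv u hu.1
  have hcore : ∀ i, Sum.elim (fun i => (b₁ i : H)) (fun i => (b₂ i : H)) i ∈ core E Q := by
    rintro (i | i)
    · exact (b₁ i).2.1
    · exact hW₂core (b₂ i).2
  have hon : Orthonormal 𝕜 w₀ := by
    refine (b₁.orthonormal_coe.sumElim b₂.orthonormal_coe fun i j => ?_).sumElim
      (b₃.orthonormal_coe.sumElim b₄.orthonormal_coe fun i j => ?_) ?_
    · exact inner_eq_zero_symm.1 ((Submodule.mem_orthogonal _ _).1 (b₁ i).2.2 _ (b₂ j).2)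
    · exact (Submodule.mem_orthogonal _ _).1 (b₄ j).2 _ (h.orthogonal_range_le (b₃ i).2)
    · rintro i (j | j)
      · exact hcoreQ _ (hcore i) _ (b₃ j).2
      · exact hcoreE _ (hcore i) _ (b₄ j).2
  have hcoreperp : ∀ v, v ∈ W₁ᗮ → v ∈ W₂ᗮ → v ∈ (core E Q)ᗮ := by
    intro v h1 h2
    rw [Submodule.mem_orthogonal]
    intro c hc
    obtain ⟨c₁, hc₁, c₂, hc₂, rfl⟩ := W₂.exists_add_mem_mem_orthogonal c
    have hc₂' : c₂ ∈ core E Q := by simpa using sub_mem hc (hW₂core hc₁)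
    rw [inner_add_left, (Submodule.mem_orthogonal _ _).1 h2 _ hc₁,
      (Submodule.mem_orthogonal _ _).1 h1 _ ⟨hc₂', hc₂⟩, add_zero]
  have hbot : (Submodule.span 𝕜 (Set.range w₀))ᗮ = ⊥ := by
    rw [eq_bot_iff]
    intro v hv
    have hv' : ∀ s, inner 𝕜 (w₀ s) v = 0 :=
      fun s => (Submodule.mem_orthogonal _ _).1 hv _ (Submodule.subset_span ⟨s, rfl⟩)
    have h1 : v ∈ W₁ᗮ := b₁.mem_orthogonal_of_forall fun i => hv' (Sum.inl (Sum.inl i))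
    have h2 : v ∈ W₂ᗮ := b₂.mem_orthogonal_of_forall fun i => hv' (Sum.inl (Sum.inr i))
    have h3 := b₃.mem_orthogonal_of_forall fun i => hv' (Sum.inr (Sum.inl i))
    have h4 := b₄.mem_orthogonal_of_forall fun i => hv' (Sum.inr (Sum.inr i))
    rw [Submodule.orthogonal_orthogonal] at h3 h4
    exact inner_self_eq_zero.1 ((Submodule.mem_orthogonal _ _).1 (hcoreperp v h1 h2) _ ⟨h4, h3⟩)
  have hlin : LinearIndependent 𝕜 x := by
    rw [Fintype.linearIndependent_iff]
    intro c hc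
    have hwlin := Fintype.linearIndependent_iff.1 hon.linearIndependent
    -- `E` kills the fourth group and sends the others to orthonormal vectors; once their
    -- coefficients vanish, `Q` does the same for the fourth group.
    have hE := congrArg E hc
    have hc0 := hwlin (Sum.elim (fun i => c (Sum.inl i))
      (Sum.elim (fun i => c (Sum.inr (Sum.inl i))) 0)) (by
        rw [map_zero, map_sum] at hE
        rw [← hE]
        simp [hw₀, hx, Fintype.sum_sum_type, hx₁E, hx₂E, hx₃E, LinearMap.mem_ker.1 (hx₄E _)])
    have hc12 : ∀ i, c (Sum.inl i) = 0 := fun i => hc0 (Sum.inl i)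
    have hc3 : ∀ i, c (Sum.inr (Sum.inl i)) = 0 := fun i => hc0 (Sum.inr (Sum.inl i))
    have hQ := congrArg Q hc
    have hc4 := hwlin (Sum.elim 0 (Sum.elim 0 fun i => c (Sum.inr (Sum.inr i)))) (by
        rw [map_zero, map_sum] at hQ
        rw [← hQ]
        simp [hw₀, hx, Fintype.sum_sum_type, hx₄Q, hc12, hc3])
    rintro (i | i | i)
    · exact hc12 i
    · exact hc3 i
    · exact hc4 (Sum.inr (Sum.inr i))
  have hxD : ∀ i, x (Sum.inl i) ∈ coreDomain E Q L := by
    rintro (i | i)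
    · exact hx₁D i
    · exact (hx₂K i).1
  obtain ⟨w, hw⟩ : ∃ w : OrthonormalBasis _ 𝕜 H, ⇑w = w₀ :=
    ⟨OrthonormalBasis.mkOfOrthogonalEqBot hon hbot, by simp⟩
  refine ⟨_, _, _, _, w, x, hlin, ?_, ?_, ?_, ?_, ?_,
    ?_, ?_, ?_, ?_, ?_, ?_, ?_⟩
  all_goals try simp only [hw]
  · rintro (i | i)
    · exact hx₁E i
    · exact hx₂E i
  · exact hx₃E
  · exact hx₄E
  · exact hx₃Q
  · exact hx₄Q
  · exact fun i y => inner_eq_zero_symm.1 ((Submodule.mem_orthogonal _ _).1 (b₃ i).2 _ ⟨y, rfl⟩)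
  · exact fun i j => inner_eq_zero_symm.1
      ((Submodule.mem_orthogonal _ _).1 (b₄ i).2 _ (mem_coreDomain.1 (hxD j)).2)
  · exact fun i j => (Submodule.mem_orthogonal _ _).1 (mem_coreKer.1 (hx₂K j)).2 _ (hcore i)
  · convert hb₁ using 4 with i j
    exact (Submodule.inner_orthogonalProjectionOnto_eq_of_mem_left (b₁ i) _).symm
  · refine Matrix.isUnit_of_inner_apply (x := fun j => x (Sum.inl (Sum.inl j)))
      (hlin.comp (fun j => Sum.inl (Sum.inl j)) (Sum.inl_injective.comp Sum.inl_injective))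
      (coreDomain E Q L ⊓ W₁.comap E) (fun i => ⟨hx₁D i, ?_⟩) (L ∘ₗ Q) fun v hv hv0 => ?_
    · change E (x₁ i) ∈ W₁
      rw [hx₁E]
      exact (b₁ i).2
    · have h1 := h.mem_coreKer_of_orthogonal hv.1 (b₁.mem_orthogonal_of_forall hv0)
      exact h.eq_zero_of_mem_coreDomain hv.1 (inner_self_eq_zero.1
        ((Submodule.mem_orthogonal _ _).1 hv.2.2 _ ⟨v, h1, rfl⟩))
  · refine Matrix.isUnit_of_inner_apply (x := fun j => x (Sum.inr (Sum.inr j)))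
      (hlin.comp (fun j => Sum.inr (Sum.inr j)) (Sum.inr_injective.comp Sum.inr_injective))
      (LinearMap.ker E) hx₄E (L ∘ₗ Q) fun v hv hv0 => ?_
    have h1 := b₄.mem_orthogonal_of_forall hv0
    rw [Submodule.orthogonal_orthogonal] at h1
    obtain ⟨y, hy⟩ := h1
    exact h.eq_zero v y hv hy.symm
  · refine Matrix.isUnit_of_inner_apply (x := fun j => x (Sum.inl j))
      (hlin.comp Sum.inl Sum.inl_injective) (coreDomain E Q L) hxD Q fun v hv hv0 => ?_
    exact h.eq_zero_of_Q_orthogonal hv (hcoreperp _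
      (b₁.mem_orthogonal_of_forall fun i => hv0 (Sum.inl i))
      (b₂.mem_orthogonal_of_forall fun i => hv0 (Sum.inr i)))

/-! ### The condensed form of matrices -/

section
variable {𝕜 : Type*} [RCLike 𝕜] {n : ℕ}

theorem Matrix.mul_mul_apply_eq_inner {ι : Type*} (M : Matrix (Fin n) (Fin n) 𝕜)
    (w x : ι → EuclideanSpace 𝕜 (Fin n)) (e : ι ≃ Fin n) (s t : ι) :
    ((of fun i k => star (w (e.symm i) k)) * M * of fun k j => x (e.symm j) k) (e s) (e t) =
      inner 𝕜 (w s) (toEuclideanLin M (x t)) := by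
  rw [EuclideanSpace.inner_eq_star_dotProduct, Matrix.mul_assoc, dotProduct_comm]
  simp [Matrix.mul_apply, dotProduct, mulVec]

theorem DissipativePencil.of_matrix {E Q L : Matrix (Fin n) (Fin n) 𝕜} (hEQ : Eᴴ * Q = Qᴴ * E)
    (hpos : (Eᴴ * Q).PosSemidef) (hL : (-(L + Lᴴ)).PosSemidef)
    (hzero : ∀ x y : Fin n → 𝕜, E *ᵥ x = 0 → (L * Q) *ᵥ x = E *ᵥ y → x = 0) :
    DissipativePencil (toEuclideanLin E) (toEuclideanLin Q) (toEuclideanLin L) where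
  symm x y := by
    simp only [EuclideanSpace.inner_eq_star_dotProduct, ofLp_toLpLin, toLin'_apply]
    rw [dotProduct_comm, dotProduct_comm (E *ᵥ _), star_mulVec, star_mulVec, ← dotProduct_mulVec,
      ← dotProduct_mulVec, mulVec_mulVec, mulVec_mulVec, hEQ]
  nonneg x := by
    simp only [EuclideanSpace.inner_eq_star_dotProduct, ofLp_toLpLin, toLin'_apply]
    rw [dotProduct_comm, star_mulVec, ← dotProduct_mulVec, mulVec_mulVec]
    exact hpos.re_dotProduct_nonneg _
  dissipative x := by
    simp only [EuclideanSpace.inner_eq_star_dotProduct, ofLp_toLpLin, toLin'_apply]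
    have h1 := hL.re_dotProduct_nonneg x.ofLp
    rw [neg_mulVec, add_mulVec, dotProduct_neg, dotProduct_add, map_neg, map_add,
      dotProduct_mulVec _ Lᴴ, ← star_mulVec] at h1
    have h2 : RCLike.re (star x.ofLp ⬝ᵥ L *ᵥ x.ofLp) =
        RCLike.re (star (L *ᵥ x.ofLp) ⬝ᵥ x.ofLp) := by
      rw [star_dotProduct, RCLike.star_def, RCLike.conj_re]
    rw [dotProduct_comm]
    linarith
  eq_zero x y hx hxy := by
    have h1 := hzero x.ofLp y.ofLp (congrArg WithLp.ofLp hx)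
      (by simpa [mulVec_mulVec] using congrArg WithLp.ofLp hxy)
    exact (WithLp.ofLp_injective 2) h1

theorem IsCondensingBasis.hasCondensedForm {E Q L : Matrix (Fin n) (Fin n) 𝕜}
    {Tri : ∀ {m : ℕ}, Matrix (Fin m) (Fin m) 𝕜 → Prop} {n₁ n₂ n₃ n₄ : ℕ}
    {w : OrthonormalBasis ((Fin n₁ ⊕ Fin n₂) ⊕ (Fin n₃ ⊕ Fin n₄)) 𝕜 (EuclideanSpace 𝕜 (Fin n))}
    {x : (Fin n₁ ⊕ Fin n₂) ⊕ (Fin n₃ ⊕ Fin n₄) → EuclideanSpace 𝕜 (Fin n)}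
    (h : IsCondensingBasis (toEuclideanLin E) (toEuclideanLin Q) (toEuclideanLin L) Tri w x) :
    HasCondensedForm E Q L Tri := by
  have hn : (n₁ + n₂) + (n₃ + n₄) = n := by
    have := Module.finrank_eq_card_basis w.toBasis
    simpa using this.symm
  set e := partitionEquiv hn
  have hw : ∀ s t, inner 𝕜 (w s) (w t) = if s = t then 1 else 0 :=
    orthonormal_iff_ite.1 w.orthonormal
  -- The rows are conjugated because the inner product is conjugate-linear in its first argument.
  set U : Matrix (Fin n) (Fin n) 𝕜 := of fun i k => star (w (e.symm i) k) with hU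
  set X : Matrix (Fin n) (Fin n) 𝕜 := of fun k j => x (e.symm j) k
  have key : ∀ M : Matrix (Fin n) (Fin n) 𝕜, (U * M * X).submatrix e e =
      of fun s t => inner 𝕜 (w s) (toEuclideanLin M (x t)) :=
    fun M => Matrix.ext fun s t => mul_mul_apply_eq_inner M w x e s t
  refine ⟨n₁, n₂, n₃, n₄, hn, U, X,
    of fun i j => inner 𝕜 (w (Sum.inl (Sum.inl i))) (toEuclideanLin Q (x (Sum.inl (Sum.inl j)))),
    of fun i j => inner 𝕜 (w (Sum.inl (Sum.inl i))) (toEuclideanLin Q (x (Sum.inl (Sum.inr j)))),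
    of fun i j => inner 𝕜 (w (Sum.inl (Sum.inr i))) (toEuclideanLin Q (x (Sum.inl (Sum.inl j)))),
    of fun i j => inner 𝕜 (w (Sum.inl (Sum.inr i))) (toEuclideanLin Q (x (Sum.inl (Sum.inr j)))),
    of fun i j => inner 𝕜 (w (Sum.inr (Sum.inr i))) (toEuclideanLin Q (x (Sum.inl (Sum.inl j)))),
    of fun i j => inner 𝕜 (w (Sum.inr (Sum.inr i))) (toEuclideanLin Q (x (Sum.inl (Sum.inr j)))),
    -- `E` sends the first two groups of `x` to the corresponding vectors of `w`.
    1, 0, 1, _,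
    of fun i j => inner 𝕜 (w (Sum.inl (Sum.inl i)))
      (toEuclideanLin L (toEuclideanLin Q (x (Sum.inr (Sum.inr j))))),
    of fun i j => inner 𝕜 (w (Sum.inl (Sum.inr i)))
      (toEuclideanLin L (toEuclideanLin Q (x (Sum.inl (Sum.inl j))))),
    of fun i j => inner 𝕜 (w (Sum.inl (Sum.inr i)))
      (toEuclideanLin L (toEuclideanLin Q (x (Sum.inr (Sum.inr j))))),
    of fun i j => inner 𝕜 (w (Sum.inr (Sum.inl i)))
      (toEuclideanLin L (toEuclideanLin Q (x (Sum.inl (Sum.inl j))))),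
    of fun i j => inner 𝕜 (w (Sum.inr (Sum.inl i)))
      (toEuclideanLin L (toEuclideanLin Q (x (Sum.inl (Sum.inr j))))),
    of fun i j => inner 𝕜 (w (Sum.inr (Sum.inl i)))
      (toEuclideanLin L (toEuclideanLin Q (x (Sum.inr (Sum.inr j))))), _,
    ?_, ?_, ?_, ?_, ?_, blockTriangular_one, isUnit_one, blockTriangular_one, isUnit_one,
    h.tri, h.isUnit_A₁₁, h.isUnit_A₄₄, ?_⟩
  · rw [mem_unitaryGroup_iff]
    ext i j
    have := hw (e.symm i) (e.symm j)
    rw [EuclideanSpace.inner_eq_star_dotProduct, dotProduct_comm] at this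
    simpa [hU, Matrix.mul_apply, star_eq_conjTranspose, dotProduct, Matrix.one_apply] using this
  · rw [← linearIndependent_cols_iff_isUnit]
    have h1 := (h.linearIndependent.comp e.symm e.symm.injective).map'
      (WithLp.linearEquiv 2 𝕜 (Fin n → 𝕜)).toLinearMap (LinearEquiv.ker _)
    exact h1
  · rw [key]
    ext ((i | i) | (i | i)) ((j | j) | (j | j)) <;>
      simp [h.Q_inr_inl, h.Q_inr_inr, h.inner_Q, hw, Matrix.one_apply]
  · rw [key]
    ext ((i | i) | (i | i)) ((j | j) | (j | j)) <;>
      simp [h.E_inl, h.E_inr_inl, h.E_inr_inr, hw, Matrix.one_apply]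
  · rw [key]
    ext ((i | i) | (i | i)) ((j | j) | (j | j)) <;>
      simp [h.Q_inr_inl, h.inner_inl, h.inner_inr_inr]
  · convert h.isUnit_Q using 1
    ext (i | i) (j | j) <;> rfl

theorem hasCondensedForm_of_triangularization {E Q L : Matrix (Fin n) (Fin n) 𝕜}
    (hEQ : Eᴴ * Q = Qᴴ * E) (hpos : (Eᴴ * Q).PosSemidef) (hL : (-(L + Lᴴ)).PosSemidef)
    (hzero : ∀ x y : Fin n → 𝕜, E *ᵥ x = 0 → (L * Q) *ᵥ x = E *ᵥ y → x = 0)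
    (Tri : ∀ {m : ℕ}, Matrix (Fin m) (Fin m) 𝕜 → Prop)
    (hTri : ∀ (W : Submodule 𝕜 (EuclideanSpace 𝕜 (Fin n))) (T : W →ₗ[𝕜] W),
      ∃ b : OrthonormalBasis (Fin (Module.finrank 𝕜 W)) 𝕜 W,
        Tri (Matrix.of fun i j => inner 𝕜 (b i) (T (b j)))) : HasCondensedForm E Q L Tri := by
  obtain ⟨_, _, _, _, _, _, h⟩ :=
    (DissipativePencil.of_matrix hEQ hpos hL hzero).exists_isCondensingBasis Tri hTri
  exact h.hasCondensedForm

end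

theorem hasCondensedForm_complex {n : ℕ} {E Q L : Matrix (Fin n) (Fin n) ℂ}
    (hEQ : Eᴴ * Q = Qᴴ * E) (hpos : (Eᴴ * Q).PosSemidef) (hL : (-(L + Lᴴ)).PosSemidef)
    (hreg : IsRegularPencil E (L * Q)) (hind : ∃ ν : ℕ, HasIndex E (L * Q) ν ∧ ν ≤ 1) :
    HasCondensedForm E Q L (fun T => T.IsLowerTriangular) := by
  refine hasCondensedForm_of_triangularization hEQ hpos hL
    (fun x y => eq_zero_of_isRegularPencil_of_hasIndex hreg hind) _ fun W T => ?_
  obtain ⟨b, β, hmono, hcard, htri⟩ := exists_orthonormalBasis_lower_blockTriangular 1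
    exists_invariant_finrank_le_one _ W T rfl
  -- Blocks of size at most one make the monotone labelling strictly monotone.
  refine ⟨b, fun i j hij => htri i j ((hmono (le_of_lt hij)).lt_of_ne fun e => ?_)⟩
  exact hij.ne (Finset.card_le_one.1 (hcard (β j)) j (by simp) i (by simpa using! e))

theorem hasCondensedForm_real {n : ℕ} {E Q L : Matrix (Fin n) (Fin n) ℝ}
    (hEQ : Eᵀ * Q = Qᵀ * E) (hpos : (Eᵀ * Q).PosSemidef) (hL : (-(L + Lᵀ)).PosSemidef)
    (hzero : ∀ x y : Fin n → ℝ, E *ᵥ x = 0 → (L * Q) *ᵥ x = E *ᵥ y → x = 0) :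
    HasCondensedForm E Q L (fun T => IsLowerQuasiTriangular T) := by
  simp only [← conjTranspose_eq_transpose_of_trivial] at hEQ hpos hL
  refine hasCondensedForm_of_triangularization hEQ hpos hL hzero _ fun W T => ?_
  obtain ⟨b, β, hmono, hcard, htri⟩ := exists_orthonormalBasis_lower_blockTriangular 2
    exists_invariant_finrank_le_two _ W T rfl
  exact ⟨b, β, hmono, hcard, fun i j hij => htri i j hij⟩

theorem Matrix.map_ofReal_conjTranspose {m n : Type*} (M : Matrix m n ℝ) :
    (M.map ((↑) : ℝ → ℂ))ᴴ = (Mᵀ).map ((↑) : ℝ → ℂ) := by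
  ext i j
  simp

-- A factorization `M = Bᵀ * B` survives complexification.
open scoped MatrixOrder in
theorem Matrix.PosSemidef.map_ofReal {n : ℕ} {M : Matrix (Fin n) (Fin n) ℝ} (hM : M.PosSemidef) :
    (M.map ((↑) : ℝ → ℂ)).PosSemidef := by
  obtain ⟨B, rfl⟩ := CStarAlgebra.nonneg_iff_eq_star_mul_self.1 hM.nonneg
  rw [star_eq_conjTranspose, conjTranspose_eq_transpose_of_trivial]
  have h : (Bᵀ * B).map ((↑) : ℝ → ℂ) = Bᵀ.map ((↑) : ℝ → ℂ) * B.map ((↑) : ℝ → ℂ) :=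
    Matrix.map_mul (f := Complex.ofRealHom)
  rw [h, ← map_ofReal_conjTranspose]
  exact posSemidef_conjTranspose_mul_self _

theorem theorem5p1 (n : ℕ) :
    (∀ E Q L : Matrix (Fin n) (Fin n) ℂ,
      Eᴴ * Q = Qᴴ * E → (Eᴴ * Q).PosSemidef → (-(L + Lᴴ)).PosSemidef →
      IsRegularPencil E (L * Q) →
      (∃ ν : ℕ, HasIndex E (L * Q) ν ∧ ν ≤ 1) →
      HasCondensedForm E Q L (fun T => T.IsLowerTriangular)) ∧
    (∀ E Q L : Matrix (Fin n) (Fin n) ℝ,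
      Eᵀ * Q = Qᵀ * E → (Eᵀ * Q).PosSemidef → (-(L + Lᵀ)).PosSemidef →
      IsRegularPencil (E.map ((↑) : ℝ → ℂ)) ((L * Q).map ((↑) : ℝ → ℂ)) →
      (∃ ν : ℕ, HasIndex (E.map ((↑) : ℝ → ℂ)) ((L * Q).map ((↑) : ℝ → ℂ)) ν ∧ ν ≤ 1) →
      HasCondensedForm (E.map ((↑) : ℝ → ℂ)) (Q.map ((↑) : ℝ → ℂ)) (L.map ((↑) : ℝ → ℂ))
        (fun T => T.IsLowerTriangular) ∧
      HasCondensedForm E Q L (fun T => IsLowerQuasiTriangular T)) := by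
  refine ⟨fun E Q L => hasCondensedForm_complex, fun E Q L hEQ hpos hL hreg hind => ⟨?_, ?_⟩⟩
  · have hmul : ∀ A B : Matrix (Fin n) (Fin n) ℝ, (A * B).map ((↑) : ℝ → ℂ) =
        A.map ((↑) : ℝ → ℂ) * B.map ((↑) : ℝ → ℂ) :=
      fun A B => Matrix.map_mul (f := Complex.ofRealHom)
    rw [hmul] at hreg hind
    refine hasCondensedForm_complex ?_ ?_ ?_ hreg hind
    · rw [map_ofReal_conjTranspose, map_ofReal_conjTranspose, ← hmul, hEQ, hmul]
    · rw [map_ofReal_conjTranspose, ← hmul]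
      exact hpos.map_ofReal
    · convert hL.map_ofReal using 1
      ext i j
      simp
  -- The Kronecker form is complex, but a real chain at infinity is also a chain of the complexified
  -- pencil.
  · refine hasCondensedForm_real hEQ hpos hL fun x y hx hxy => ?_
    have hmap : ∀ (M : Matrix (Fin n) (Fin n) ℝ) (v : Fin n → ℝ),
        M.map ((↑) : ℝ → ℂ) *ᵥ (fun i => (v i : ℂ)) = fun i => ((M *ᵥ v) i : ℂ) := by
      intro M v
      ext i
      simp [mulVec, dotProduct]
    have h := eq_zero_of_isRegularPencil_of_hasIndex hreg hind (x := fun i => (x i : ℂ))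
      (y := fun i => (y i : ℂ)) (by rw [hmap, hx]; ext i; simp) (by rw [hmap, hmap, hxy])
    ext i
    exact Complex.ofReal_eq_zero.1 (congrFun h i)
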